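/- Let $0<\alpha\le 1/2$, and let $S(\alpha,1,1)$ be the maximally skewed stable distribution with characteristic function $\lambda\mapsto\exp\left(-|\lambda|^\alpha\left(1-\mathrm{sign}(\lambda)\sqrt{-1}\tan\frac{\pi\alpha}{2}\right)\right)$. Let $s_{tj}$ ($1\le t\le N$, $1\le j\le M$, $M\ge 1$) be i.i.d. with law $S(\alpha,1,1)$, and fix a coordinate $i$. Consider signals $x\in\mathbb{R}^N$ with $x_t\ge 0$ for all $t$ and $x_t>0$ for at least one $t\ne i$. For such a signal, let $y_j=\sum_{t=1}^N x_ts_{tj}$ be the measurements and $y_j/s_{ij}$ the ratio statistics, $j=1,\dots,M$. (1) For each such $x$ and each $j$, the law of $y_j/s_{ij}$ has a density $f_x$ with respect to Lebesgue measure, namely the derivative $f_x(t)=\frac{d}{dt}\Pr(y_j/s_{ij}\le t)$ for $t\neq x_i$, and, as a value in $[0,\infty]$ at the remaining point, $f_x(x_i)=\lim_{r\to0+}\frac{1}{2r}\Pr\left(|y_j/s_{ij}-x_i|\le r\right)$. This density satisfies $f_x(t)\to\infty$ as $t\downarrow x_i$, and it is nonincreasing on $[x_i,\infty)$. (2) For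 each such $x$, almost surely $y_j/s_{ij}>x_i$ for all $j$, and the joint density of $(y_1/s_{i1},\dots,y_M/s_{iM})$ is the likelihood $L(x;z_1,\dots,z_M)=\prod_{j=1}^M f_x(z_j)$, a product in $[0,\infty]$ with $0\cdot\infty=0$. (3) The maximum likelihood estimator of $x_i$ based on the ratio statistics is the sample minimum $\hat x_{i,\min}=\min_{1\le j\le M}y_j/s_{ij}$: for all values $z_1,\dots,z_M\ge 0$ of the ratio statistics, a signal $x$ as above maximizes $L(\,\cdot\,;z_1,\dots,z_M)$ over all such signals if and only if $x_i=\min_{1\le j\le M}z_j$. -/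

import Mathlib

open MeasureTheory ProbabilityTheory Filter Topology
open scoped ENNReal

/-- The maximally skewed stable distribution `S(α,1,1)` with unit scale: the probability measure on
the line with characteristic function
`l ↦ exp (-|l|^α (1 - sign(l) i tan(π α / 2)))`. -/
def IsMaxSkewedStable (α : ℝ) (ν : Measure ℝ) : Prop :=
  IsProbabilityMeasure ν ∧ ∀ l : ℝ, charFun ν l =
    Complex.exp (-((|l| ^ α : ℝ) : ℂ) *
      (1 - (Real.sign l : ℂ) * Complex.I * (Real.tan (Real.pi * α / 2) : ℂ)))

/-- The linear measurement `y_j = ∑ t, x_t s_{tj}`. -/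
noncomputable def measurement {Ω : Type*} {N M : ℕ} (s : Fin N → Fin M → Ω → ℝ) (x : Fin N → ℝ)
    (j : Fin M) (ω : Ω) : ℝ :=
  ∑ t, x t * s t j ω

/-- The ratio statistic `z_{ij} = y_j / s_{ij}`. -/
noncomputable def ratioStat {Ω : Type*} {N M : ℕ} (s : Fin N → Fin M → Ω → ℝ) (x : Fin N → ℝ)
    (i : Fin N) (j : Fin M) (ω : Ω) : ℝ :=
  measurement s x j ω / s i j ω

/-- The pointwise density of a measure on the line: its upper derivative with respect to Lebesgue
measure, with values in `[0, ∞]`. -/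
noncomputable def pointDensity (ν : Measure ℝ) (t : ℝ) : ℝ≥0∞ :=
  limsup (fun r : ℝ => ν (Metric.closedBall t r) / volume (Metric.closedBall t r)) (𝓝[>] 0)

/-- The density at `t` of the ratio statistic `y_j / s_{ij}` when the signal is `x`. -/
noncomputable def ratioDensity {Ω : Type*} [MeasurableSpace Ω] (P : Measure Ω) {N M : ℕ}
    (s : Fin N → Fin M → Ω → ℝ) (x : Fin N → ℝ) (i : Fin N) (j : Fin M) (t : ℝ) : ℝ≥0∞ :=
  pointDensity (P.map (ratioStat s x i j)) t

/-- The likelihood of the signal `x` given the values `z_1, …, z_M` of the ratio statistics: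
the product of their densities. -/
noncomputable def ratioLikelihood {Ω : Type*} [MeasurableSpace Ω] (P : Measure Ω) {N M : ℕ}
    (s : Fin N → Fin M → Ω → ℝ) (i : Fin N) (z : Fin M → ℝ) (x : Fin N → ℝ) : ℝ≥0∞ :=
  ∏ j, ratioDensity P s x i j (z j)

/-- The nonnegative signals with at least one nonzero coordinate other than the `i`-th
(for the other signals, `y_j / s_{ij}` is the constant `x_i` and has no density). -/
def admissibleSignals {N : ℕ} (i : Fin N) : Set (Fin N → ℝ) :=
  {x | (∀ t, 0 ≤ x t) ∧ ∃ t, t ≠ i ∧ 0 < x t}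

section MaxSkewedStable

open Set Real

/-! Everything rests on the mean sign of a linear combination `∑ c_t X_t` of independent `S(α,1,1)`
variables. With `A = ∑ |c_t|^α`, `B = ∑ sign(c_t) |c_t|^α` and `τ = tan(πα/2)`, its characteristic
function at `l > 0` has imaginary part `exp(-A l^α) sin(τ B l^α)`. Gil-Pelaez inversion
(`integral_sign_eq_charFun`) then gives mean sign `2/(πα) · arctan(τ B / A)`.

If all `c_t ≥ 0`, then `A = B` and the mean sign is `1`: the combination is almost surely positive.
In particular `s_{ij} > 0`, so `y_j / s_{ij} - u` has the sign of `∑ (x_t - u·1_{t=i}) s_{tj}`,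
again a linear combination. This yields the distribution function of the ratio in closed form
(`stableRatioCDF`), and its derivative `stableRatioPDF`. The factor `(t - x_i)^(α-1)` makes the
density blow up at `x_i`; the condition `α ≤ 1/2`, that is `τ ≤ 1`, makes it decrease beyond `x_i`.

The density is `0` below `x_i`, `∞` at `x_i`, and positive and finite above. So the likelihood is
`∞` exactly when `x_i = min z_j` (`ratioLikelihood_eq_top_iff`), and since an admissible signal
attains `∞`, these are the maximizers. -/

/-! ### Gil-Pelaez inversion through Laplace transforms. -/

lemma integrableOn_exp_neg_mul_Ioi {v : ℝ} (hv : 0 < v) (c : ℝ) :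
    IntegrableOn (fun t : ℝ => exp (-(v * t))) (Ioi c) := by
  simpa using integrableOn_exp_mul_Ioi (neg_lt_zero.2 hv) c

lemma integral_exp_neg_mul_Ioi_zero {v : ℝ} (hv : 0 < v) :
    ∫ t in Ioi (0 : ℝ), exp (-(v * t)) = v⁻¹ := by
  have := integral_exp_mul_Ioi (neg_lt_zero.2 hv) 0
  simpa using this

lemma integral_exp_neg_mul_cexp {v : ℝ} (hv : 0 < v) (x : ℝ) :
    ∫ t in Ioi (0 : ℝ), Complex.exp ((-v + x * Complex.I) * t) = (v + x * Complex.I) / (v ^ 2 + x ^ 2) := by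
  rw [integral_exp_mul_complex_Ioi (by simpa using hv)]
  have h1 : (-v + x * Complex.I : ℂ) ≠ 0 := by
    intro h; have := congrArg Complex.re h; simp at this; exact hv.ne' this
  have h2 : (v ^ 2 + x ^ 2 : ℂ) ≠ 0 := by
    norm_cast; positivity
  simp only [Complex.ofReal_zero, mul_zero, Complex.exp_zero]
  rw [div_eq_div_iff h1 h2]
  linear_combination -(x : ℂ) ^ 2 * Complex.I_sq

lemma cexp_neg_add_mul_I (v x t : ℝ) : Complex.exp ((-v + x * Complex.I) * t) =
    (exp (-(v * t)) * cos (t * x) : ℝ) + (exp (-(v * t)) * sin (t * x) : ℝ) * Complex.I := by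
  have : ((-v + x * Complex.I) * t : ℂ) = ((-(v * t) : ℝ) : ℂ) + ((t * x : ℝ) : ℂ) * Complex.I := by
    push_cast; ring
  rw [this, Complex.exp_add_mul_I]
  push_cast; ring

lemma integral_exp_neg_mul_sin {v : ℝ} (hv : 0 < v) (x : ℝ) :
    ∫ t in Ioi (0 : ℝ), exp (-(v * t)) * sin (t * x) = x / (v ^ 2 + x ^ 2) := by
  have h := integral_exp_neg_mul_cexp hv x
  have hi : IntegrableOn (fun t : ℝ => Complex.exp ((-v + x * Complex.I) * t)) (Ioi 0) :=
    integrableOn_exp_mul_complex_Ioi (by simpa using hv) 0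
  have := integral_im hi
  simp only [RCLike.im_to_complex, h] at this
  simp only [cexp_neg_add_mul_I] at this
  simp only [Complex.add_im, Complex.ofReal_im, Complex.mul_I_im, Complex.ofReal_re, zero_add] at this
  rw [this]
  have : ((v + x * Complex.I) / (v ^ 2 + x ^ 2) : ℂ) = (v + x * Complex.I) / ((v ^ 2 + x ^ 2 : ℝ) : ℂ) := by
    push_cast; rfl
  rw [this, Complex.div_ofReal_im]; simp

lemma integral_exp_neg_mul_cos {v : ℝ} (hv : 0 < v) (x : ℝ) :
    ∫ t in Ioi (0 : ℝ), exp (-(v * t)) * cos (t * x) = v / (v ^ 2 + x ^ 2) := by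
  have h := integral_exp_neg_mul_cexp hv x
  have hi : IntegrableOn (fun t : ℝ => Complex.exp ((-v + x * Complex.I) * t)) (Ioi 0) :=
    integrableOn_exp_mul_complex_Ioi (by simpa using hv) 0
  have := integral_re hi
  simp only [RCLike.re_to_complex, h] at this
  simp only [cexp_neg_add_mul_I] at this
  simp only [Complex.add_re, Complex.ofReal_re, Complex.mul_I_re, Complex.ofReal_im, neg_zero, add_zero] at this
  rw [this]
  have : ((v + x * Complex.I) / (v ^ 2 + x ^ 2) : ℂ) = (v + x * Complex.I) / ((v ^ 2 + x ^ 2 : ℝ) : ℂ) := by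
    push_cast; rfl
  rw [this, Complex.div_ofReal_re]; simp

lemma integrableOn_div_sq_add_sq_of_pos {x : ℝ} (hx : 0 < x) :
    IntegrableOn (fun v : ℝ => x / (v ^ 2 + x ^ 2)) (Ioi 0) ∧
      ∫ v in Ioi (0 : ℝ), x / (v ^ 2 + x ^ 2) = π / 2 := by
  have hd : ∀ v ∈ Ici (0 : ℝ), HasDerivAt (fun v => arctan (v / x)) (x / (v ^ 2 + x ^ 2)) v := by
    intro v _
    refine ((hasDerivAt_id' v).div_const x).arctan.congr_deriv ?_
    field_simp
    ring
  have hl : Tendsto (fun v => arctan (v / x)) atTop (𝓝 (π / 2)) :=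
    (tendsto_arctan_atTop.mono_right nhdsWithin_le_nhds).comp (tendsto_id.atTop_div_const hx)
  have hp : ∀ v ∈ Ioi (0 : ℝ), 0 ≤ x / (v ^ 2 + x ^ 2) := fun v _ => by positivity
  refine ⟨integrableOn_Ioi_deriv_of_nonneg' hd hp hl, ?_⟩
  rw [integral_Ioi_of_hasDerivAt_of_nonneg' hd hp hl]
  simp

lemma integrableOn_div_sq_add_sq (x : ℝ) :
    IntegrableOn (fun v : ℝ => x / (v ^ 2 + x ^ 2)) (Ioi 0) := by
  rcases lt_trichotomy x 0 with h | h | h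
  · have := (integrableOn_div_sq_add_sq_of_pos (neg_pos.2 h)).1.neg
    refine this.congr_fun (fun v _ => ?_) measurableSet_Ioi
    simp [neg_div]
  · simp [h]
  · exact (integrableOn_div_sq_add_sq_of_pos h).1

/-- An absolutely convergent substitute for the Dirichlet integral `∫ sin(t x) / t dt`, so that
Fubini applies in the inversion formula. -/
lemma integral_Ioi_div_sq_add_sq (x : ℝ) :
    ∫ v in Ioi (0 : ℝ), x / (v ^ 2 + x ^ 2) = π / 2 * Real.sign x := by
  rcases lt_trichotomy x 0 with h | h | h
  · have := (integrableOn_div_sq_add_sq_of_pos (neg_pos.2 h)).2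
    simp only [neg_sq, neg_div, integral_neg] at this
    rw [sign_of_neg h]; linarith
  · simp [h]
  · rw [sign_of_pos h, (integrableOn_div_sq_add_sq_of_pos h).2, mul_one]

/-- The `sin`-transform of the law `μ`, damped by `exp (-v t)`. -/
lemma integral_Ioi_div_sq_add_sq_eq_charFun (μ : Measure ℝ) [IsProbabilityMeasure μ] {v : ℝ} (hv : 0 < v) :
    ∫ x, x / (v ^ 2 + x ^ 2) ∂μ = ∫ t in Ioi (0 : ℝ), exp (-(v * t)) * (charFun μ t).im := by
  have him : ∀ t : ℝ, (charFun μ t).im = ∫ x, sin (t * x) ∂μ := by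
    intro t
    have hi : Integrable (fun x : ℝ => Complex.exp (t * x * Complex.I)) μ := by
      refine Integrable.of_bound (C := 1) (by fun_prop) (ae_of_all _ fun x => ?_)
      rw [← Complex.ofReal_mul, Complex.norm_exp_ofReal_mul_I]
    have := integral_im hi
    rw [charFun_apply_real]
    simp only [RCLike.im_to_complex] at this
    rw [← this]
    congr 1; ext x
    rw [← Complex.ofReal_mul, Complex.exp_ofReal_mul_I_im]
  simp_rw [him, ← integral_const_mul, ← integral_exp_neg_mul_sin hv]
  apply integral_integral_swap
  have : Integrable (fun z : ℝ × ℝ => (1 : ℝ) * exp (-(v * z.2)))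
      (μ.prod (volume.restrict (Ioi 0))) :=
    (integrable_const (1 : ℝ)).mul_prod (integrableOn_exp_neg_mul_Ioi hv 0)
  refine this.mono' (by fun_prop) (ae_of_all _ fun z => ?_)
  simp only [Function.uncurry, norm_mul, norm_eq_abs, abs_exp, one_mul]
  exact mul_le_of_le_one_right (exp_pos _).le (abs_sin_le_one _)

/-- A form of the Gil-Pelaez inversion formula. -/
lemma integral_sign_eq_charFun (μ : Measure ℝ) [IsProbabilityMeasure μ]
    (h : IntegrableOn (fun t => (charFun μ t).im / t) (Ioi 0)) :
    π / 2 * ∫ x, Real.sign x ∂μ = ∫ t in Ioi (0 : ℝ), (charFun μ t).im / t := by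
  have hm : Measurable (fun t => (charFun μ t).im) := Complex.measurable_im.comp measurable_charFun
  calc π / 2 * ∫ x, Real.sign x ∂μ
      = ∫ x, (∫ v in Ioi (0 : ℝ), x / (v ^ 2 + x ^ 2)) ∂μ := by
        simp_rw [integral_Ioi_div_sq_add_sq, integral_const_mul]
    _ = ∫ v in Ioi (0 : ℝ), ∫ x, x / (v ^ 2 + x ^ 2) ∂μ := by
        apply integral_integral_swap
        rw [integrable_prod_iff (by
          apply Measurable.aestronglyMeasurable; simp only [Function.uncurry_def]; fun_prop)]
        refine ⟨ae_of_all _ fun x => integrableOn_div_sq_add_sq x, ?_⟩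
        -- The integral of the norm in `v` is bounded by `π / 2` uniformly in `x`, hence integrable
        -- for a probability measure.
        have : ∀ x : ℝ, ∫ v in Ioi (0 : ℝ), ‖Function.uncurry (fun x v : ℝ => x / (v ^ 2 + x ^ 2)) (x, v)‖
            = π / 2 * Real.sign |x| := by
          intro x
          rw [← integral_Ioi_div_sq_add_sq]
          refine setIntegral_congr_fun measurableSet_Ioi fun v _ => ?_
          simp only [Function.uncurry, norm_div, norm_eq_abs, sq_abs]
          rw [abs_of_nonneg (by positivity : 0 ≤ v ^ 2 + x ^ 2)]
        simp_rw [this]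
        refine Integrable.of_bound (C := π / 2) ?_ (ae_of_all _ fun x => ?_)
        · have : (fun x : ℝ => π / 2 * Real.sign |x|) = fun x => if x = 0 then 0 else π / 2 := by
            ext x
            split_ifs with h
            · simp [h]
            · rw [sign_of_pos (abs_pos.2 h), mul_one]
          rw [this]
          exact (Measurable.ite (measurableSet_singleton 0) (by fun_prop) (by fun_prop)).aestronglyMeasurable
        · rw [norm_mul, norm_of_nonneg (by positivity)]
          refine mul_le_of_le_one_right (by positivity) ?_
          rcases Real.sign_apply_eq |x| with h | h | h <;> simp [h]
    _ = ∫ v in Ioi (0 : ℝ), ∫ t in Ioi (0 : ℝ), exp (-(v * t)) * (charFun μ t).im := by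
        refine setIntegral_congr_fun measurableSet_Ioi fun v hv => ?_
        exact integral_Ioi_div_sq_add_sq_eq_charFun μ hv
    _ = ∫ t in Ioi (0 : ℝ), ∫ v in Ioi (0 : ℝ), exp (-(v * t)) * (charFun μ t).im := by
        apply integral_integral_swap
        rw [integrable_prod_iff' (by
          apply Measurable.aestronglyMeasurable; simp only [Function.uncurry_def]
          exact Measurable.mul (by fun_prop) (hm.comp measurable_snd))]
        constructor
        · filter_upwards [ae_restrict_mem measurableSet_Ioi] with t ht
          have := (integrableOn_exp_neg_mul_Ioi ht 0).mul_const (charFun μ t).im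
          simpa [Function.uncurry, mul_comm t, IntegrableOn] using this
        -- Since `∫ exp(-v t) dv = 1 / t`, absolute integrability on the product is exactly the
        -- hypothesis `h`.
        · refine (h.norm).congr ?_
          filter_upwards [ae_restrict_mem measurableSet_Ioi] with t ht
          simp only [Function.uncurry, norm_mul, norm_div, norm_eq_abs, abs_exp]
          rw [integral_mul_const]
          simp_rw [mul_comm _ t]
          rw [integral_exp_neg_mul_Ioi_zero ht, abs_of_pos (show 0 < t from ht)]
          ring
    _ = ∫ t in Ioi (0 : ℝ), (charFun μ t).im / t := by
        refine setIntegral_congr_fun measurableSet_Ioi fun t ht => ?_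
        rw [integral_mul_const]
        simp_rw [mul_comm _ t]
        rw [integral_exp_neg_mul_Ioi_zero ht]
        ring

/-! ### The inversion integral for stable characteristic functions. -/

lemma integrableOn_exp_neg_mul_sin_div {p : ℝ} (hp : 0 < p) (q : ℝ) :
    IntegrableOn (fun u => exp (-(p * u)) * sin (q * u) / u) (Ioi 0) := by
  refine ((integrableOn_exp_neg_mul_Ioi hp 0).const_mul |q|).mono'
    (Measurable.aestronglyMeasurable (by fun_prop)) ?_
  filter_upwards [ae_restrict_mem measurableSet_Ioi] with u hu
  have hu : 0 < u := hu
  rw [norm_div, norm_mul, norm_eq_abs, norm_eq_abs, norm_eq_abs, abs_exp, abs_of_pos hu,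
    div_le_iff₀ hu]
  have : |sin (q * u)| ≤ |q| * u := by
    rw [← abs_of_pos hu, ← abs_mul, abs_of_pos hu]; exact abs_sin_le_abs
  nlinarith [exp_pos (-(p * u))]

/-- Write `sin(q u) / u` as `∫ cos(u w) dw` over `[0, q]`, swap the integrals, and integrate `p /
(p² + w²)`. -/
lemma integral_exp_neg_mul_sin_div {p : ℝ} (hp : 0 < p) (q : ℝ) :
    ∫ u in Ioi (0 : ℝ), exp (-(p * u)) * sin (q * u) / u = arctan (q / p) := by
  have h1 : ∫ w in (0 : ℝ)..q, ∫ u in Ioi (0 : ℝ), exp (-(p * u)) * cos (u * w)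
      = ∫ u in Ioi (0 : ℝ), ∫ w in (0 : ℝ)..q, exp (-(p * u)) * cos (u * w) := by
    apply intervalIntegral_integral_swap
    have : IsFiniteMeasure (volume.restrict (uIoc 0 q)) := ⟨by simp [uIoc]⟩
    have : Integrable (fun z : ℝ × ℝ => (1 : ℝ) * exp (-(p * z.2)))
        ((volume.restrict (uIoc 0 q)).prod (volume.restrict (Ioi 0))) :=
      (integrable_const (1 : ℝ)).mul_prod (integrableOn_exp_neg_mul_Ioi hp 0)
    refine this.mono' (by fun_prop) (ae_of_all _ fun z => ?_)
    simp only [Function.uncurry, norm_mul, norm_eq_abs, abs_exp, one_mul]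
    exact mul_le_of_le_one_right (exp_pos _).le (abs_cos_le_one _)
  have h2 : ∫ w in (0 : ℝ)..q, ∫ u in Ioi (0 : ℝ), exp (-(p * u)) * cos (u * w) = arctan (q / p) := by
    simp_rw [integral_exp_neg_mul_cos hp]
    rw [intervalIntegral.integral_eq_sub_of_hasDerivAt (f := fun w => arctan (w / p))]
    · simp
    · intro w _
      refine ((hasDerivAt_id' w).div_const p).arctan.congr_deriv ?_
      have : p ^ 2 + w ^ 2 ≠ 0 := by positivity
      field_simp
    · apply Continuous.intervalIntegrable
      have : ∀ w : ℝ, p ^ 2 + w ^ 2 ≠ 0 := fun w => by positivity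
      fun_prop (disch := assumption)
  rw [← h2, h1]
  refine setIntegral_congr_fun measurableSet_Ioi fun u hu => ?_
  have hu : 0 < u := hu
  rw [intervalIntegral.integral_const_mul, intervalIntegral.integral_comp_mul_left _ hu.ne', integral_cos]
  simp only [mul_zero, sin_zero, sub_zero, smul_eq_mul]
  rw [mul_comm u q, div_eq_inv_mul]; ring

lemma rpow_smul_exp_neg_mul_sin_div {α : ℝ} (A B : ℝ) {t : ℝ} (ht : 0 < t) :
    t ^ (α - 1) • (exp (-(A * t ^ α)) * sin (B * t ^ α) / t ^ α) =
      exp (-(A * t ^ α)) * sin (B * t ^ α) / t := by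
  have : t ^ α ≠ 0 := (rpow_pos_of_pos ht α).ne'
  rw [rpow_sub_one ht.ne', smul_eq_mul]
  field_simp

lemma integrableOn_exp_neg_rpow_mul_sin_div {α A : ℝ} (hα : 0 < α) (hA : 0 < A) (B : ℝ) :
    IntegrableOn (fun t : ℝ => exp (-(A * t ^ α)) * sin (B * t ^ α) / t) (Ioi 0) :=
  ((integrableOn_Ioi_comp_rpow_iff' _ hα.ne').2 (integrableOn_exp_neg_mul_sin_div hA B)).congr_fun
    (fun _ ht => rpow_smul_exp_neg_mul_sin_div A B ht) measurableSet_Ioi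

/-- Substitute `u = t^α`: then `dt / t = du / (α u)`. -/
lemma integral_exp_neg_rpow_mul_sin_div {α A : ℝ} (hα : 0 < α) (hA : 0 < A) (B : ℝ) :
    ∫ t in Ioi (0 : ℝ), exp (-(A * t ^ α)) * sin (B * t ^ α) / t = arctan (B / A) / α := by
  have h := integral_comp_rpow_Ioi_of_pos (g := fun u : ℝ => exp (-(A * u)) * sin (B * u) / u) hα
  rw [integral_exp_neg_mul_sin_div hA] at h
  rw [← h, eq_div_iff hα.ne', mul_comm, ← integral_const_mul]
  refine setIntegral_congr_fun measurableSet_Ioi fun t ht => ?_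
  rw [← rpow_smul_exp_neg_mul_sin_div A B ht, smul_eq_mul, smul_eq_mul, mul_assoc]

lemma measurable_real_sign : Measurable Real.sign :=
  Measurable.ite measurableSet_Iio measurable_const
    (Measurable.ite measurableSet_Ioi measurable_const measurable_const)

lemma abs_real_sign_le_one (x : ℝ) : |Real.sign x| ≤ 1 := by
  rcases Real.sign_apply_eq x with h | h | h <;> simp [h]

/-! ### Signs of linear combinations of maximally skewed stable variables. -/

section LinearCombination

variable {Ω ι : Type*} [MeasurableSpace Ω] {P : Measure Ω} [Fintype ι] {α : ℝ} {X : ι → Ω → ℝ}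

lemma im_charFun_map_sum_of_isMaxSkewedStable (hX : ∀ t, Measurable (X t))
    (hlaw : ∀ t, IsMaxSkewedStable α (P.map (X t))) (hind : iIndepFun X P) (c : ι → ℝ)
    {l : ℝ} (hl : 0 < l) :
    (charFun (P.map fun ω => ∑ t, c t * X t ω) l).im =
      exp (-((∑ t, |c t| ^ α) * l ^ α)) *
        sin (tan (π * α / 2) * (∑ t, Real.sign (c t) * |c t| ^ α) * l ^ α) := by
  have hind' : iIndepFun (fun t ω => c t * X t ω) P :=
    hind.comp (fun t x => c t * x) fun t => measurable_const_mul _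
  rw [hind'.charFun_map_fun_sum_eq_prod (fun t => ((hX t).const_mul _).aemeasurable),
    Finset.prod_apply]
  have : ∀ t, charFun (P.map fun ω => c t * X t ω) l = Complex.exp
      ((-(|c t| ^ α * l ^ α) : ℝ) +
        (tan (π * α / 2) * (Real.sign (c t) * |c t| ^ α) * l ^ α : ℝ) * Complex.I) := by
    intro t
    rw [charFun_map_mul_comp (hX t).aemeasurable, (hlaw t).2, abs_mul, abs_of_pos hl,
      mul_rpow (abs_nonneg _) hl.le]
    have hs : Real.sign (c t * l) = Real.sign (c t) := by
      rcases lt_trichotomy (c t) 0 with h | h | h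
      · rw [sign_of_neg h, sign_of_neg (mul_neg_of_neg_of_pos h hl)]
      · simp [h]
      · rw [sign_of_pos h, sign_of_pos (mul_pos h hl)]
    rw [hs]
    congr 1
    push_cast
    ring
  simp_rw [this]
  rw [← Complex.exp_sum, Finset.sum_add_distrib, ← Finset.sum_mul, ← Complex.ofReal_sum,
    ← Complex.ofReal_sum, Complex.exp_add, ← Complex.ofReal_exp, Complex.im_ofReal_mul,
    Complex.exp_ofReal_mul_I_im, Finset.sum_neg_distrib, Finset.sum_mul, Finset.mul_sum,
    Finset.sum_mul]

lemma integral_sign_sum_of_isMaxSkewedStable [IsProbabilityMeasure P] (hα : 0 < α)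
    (hX : ∀ t, Measurable (X t))
    (hlaw : ∀ t, IsMaxSkewedStable α (P.map (X t))) (hind : iIndepFun X P) (c : ι → ℝ)
    (hc : 0 < ∑ t, |c t| ^ α) :
    ∫ ω, Real.sign (∑ t, c t * X t ω) ∂P = 2 / (π * α) *
      arctan (tan (π * α / 2) * (∑ t, Real.sign (c t) * |c t| ^ α) / ∑ t, |c t| ^ α) := by
  have hm : Measurable fun ω => ∑ t, c t * X t ω :=
    Finset.measurable_sum _ fun t _ => (hX t).const_mul _
  have := Measure.isProbabilityMeasure_map (μ := P) hm.aemeasurable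
  have heq : EqOn (fun t : ℝ => exp (-((∑ t, |c t| ^ α) * t ^ α)) *
        sin (tan (π * α / 2) * (∑ t, Real.sign (c t) * |c t| ^ α) * t ^ α) / t)
      (fun t => (charFun (P.map fun ω => ∑ t, c t * X t ω) t).im / t) (Ioi 0) := fun l hl => by
    simp only
    rw [im_charFun_map_sum_of_isMaxSkewedStable hX hlaw hind c hl]
  have h := integral_sign_eq_charFun (P.map fun ω => ∑ t, c t * X t ω)
    ((integrableOn_exp_neg_rpow_mul_sin_div hα hc _).congr_fun heq measurableSet_Ioi)
  rw [← setIntegral_congr_fun measurableSet_Ioi heq, integral_exp_neg_rpow_mul_sin_div hα hc,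
    integral_map hm.aemeasurable] at h
  · have := pi_pos
    field_simp at h ⊢
    linarith
  · exact measurable_real_sign.aestronglyMeasurable

/-- With nonnegative coefficients the arctangent is that of `tan(πα/2)`, and `α < 1` lets it cancel.
The mean sign is therefore `1`, the largest possible value, which forces the sign to be `1` almost
surely. -/
lemma ae_sum_pos_of_isMaxSkewedStable [IsProbabilityMeasure P] (hα : 0 < α) (hα1 : α < 1)
    (hX : ∀ t, Measurable (X t))
    (hlaw : ∀ t, IsMaxSkewedStable α (P.map (X t))) (hind : iIndepFun X P) (c : ι → ℝ)
    (hc : ∀ t, 0 ≤ c t) (hc' : ∃ t, 0 < c t) :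
    ∀ᵐ ω ∂P, 0 < ∑ t, c t * X t ω := by
  have hm : Measurable fun ω => ∑ t, c t * X t ω :=
    Finset.measurable_sum _ fun t _ => (hX t).const_mul _
  obtain ⟨t₀, ht₀⟩ := hc'
  have hpos : 0 < ∑ t, |c t| ^ α :=
    Finset.sum_pos' (fun t _ => by positivity) ⟨t₀, Finset.mem_univ _, by positivity⟩
  have hs : ∀ t, Real.sign (c t) * |c t| ^ α = |c t| ^ α := fun t => by
    rcases (hc t).eq_or_lt with h | h
    · simp [← h, hα.ne']
    · rw [sign_of_pos h, one_mul]
  have hint := integral_sign_sum_of_isMaxSkewedStable hα hX hlaw hind c hpos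
  simp_rw [hs] at hint
  have := pi_pos
  rw [mul_div_assoc, div_self hpos.ne', mul_one, arctan_tan (by nlinarith) (by nlinarith)] at hint
  have hi : Integrable (fun ω => Real.sign (∑ t, c t * X t ω)) P :=
    Integrable.of_bound (C := 1) (measurable_real_sign.comp hm).aestronglyMeasurable
      (ae_of_all _ fun ω => abs_real_sign_le_one _)
  have h0 : ∫ ω, (1 - Real.sign (∑ t, c t * X t ω)) ∂P = 0 := by
    rw [integral_sub (integrable_const _) hi, hint]
    simp
    field_simp
    ring
  have h1 := (integral_eq_zero_iff_of_nonneg (μ := P)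
    (f := fun ω => 1 - Real.sign (∑ t, c t * X t ω))
    (fun ω => sub_nonneg.2 (le_of_abs_le (abs_real_sign_le_one _)))
    ((integrable_const _).sub hi)).1 h0
  filter_upwards [h1] with ω hω
  by_contra hneg
  rcases (not_lt.1 hneg).lt_or_eq with h | h
  · norm_num [sign_of_neg h] at hω
  · simp [h] at hω

end LinearCombination

/-! ### From mean signs to distribution functions and densities. -/

section DistributionFunction

variable {μ : Measure ℝ} [IsProbabilityMeasure μ] {F : ℝ → ℝ}

lemma integral_sign_sub (u : ℝ) :
    ∫ z, Real.sign (z - u) ∂μ = 1 - μ.real (Iic u) - μ.real (Iio u) := by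
  have h : (fun z => Real.sign (z - u)) =
      fun z => (Ioi u).indicator 1 z - (Iio u).indicator 1 z := by
    ext z
    rcases lt_trichotomy z u with h | h | h
    · simp [sign_of_neg (sub_neg.2 h), h, h.le]
    · simp [h]
    · simp [sign_of_pos (sub_pos.2 h), h, h.le]
  rw [h, integral_sub ((integrable_const _).indicator measurableSet_Ioi)
    ((integrable_const _).indicator measurableSet_Iio), integral_indicator_one measurableSet_Ioi,
    integral_indicator_one measurableSet_Iio, ← compl_Iic, probReal_compl_eq_one_sub measurableSet_Iic]

/-- The mean sign only determines the average of `μ (Iic u)` and `μ (Iio u)`. Continuity of `F`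
excludes atoms: for `w > u`, `μ (Iic u) ≤ μ (Iio w) ≤ F w`, and `w` tends to `u`. -/
lemma measureReal_Iic_eq_of_integral_sign (hF : Continuous F)
    (h : ∀ u, ∫ z, Real.sign (z - u) ∂μ = 1 - 2 * F u) (u : ℝ) : μ.real (Iic u) = F u := by
  have h2 : ∀ u, μ.real (Iic u) + μ.real (Iio u) = 2 * F u := fun u => by
    have := h u
    rw [integral_sign_sub] at this
    linarith
  have hle : ∀ u, μ.real (Iio u) ≤ μ.real (Iic u) := fun u => measureReal_mono Iio_subset_Iic_self
  refine le_antisymm ?_ (by linarith [h2 u, hle u])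
  refine ge_of_tendsto (hF.continuousWithinAt (s := Ioi u) (x := u)) ?_
  filter_upwards [self_mem_nhdsWithin] with w hw
  have : μ.real (Iic u) ≤ μ.real (Iio w) := measureReal_mono (Iic_subset_Iio.2 hw)
  linarith [h2 w, hle w]

lemma measure_Icc_eq_of_continuous_cdf (hF : Continuous F) (h : ∀ u, μ.real (Iic u) = F u)
    (a b : ℝ) : μ (Icc a b) = ENNReal.ofReal (F b - F a) := by
  have hc : ∀ u, cdf μ u = F u := fun u => by rw [cdf_eq_real, h]
  have hc' : (cdf μ : ℝ → ℝ) = F := funext hc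
  rw [← measure_cdf μ, StieltjesFunction.measure_Icc, hc']
  rw [hF.continuousAt.continuousWithinAt.leftLim_eq]

/-- The ratio over a closed ball is the symmetric difference quotient of `F`, so the upper
derivative is a genuine limit. -/
lemma pointDensity_eq_of_hasDerivAt (hF : Continuous F) (h : ∀ u, μ.real (Iic u) = F u)
    {t d : ℝ} (hd : HasDerivAt F d t) : pointDensity μ t = ENNReal.ofReal d := by
  refine Tendsto.limsup_eq ?_
  have hq : Tendsto (fun r : ℝ => (F (t + r) - F (t - r)) / (2 * r)) (𝓝[>] 0) (𝓝 d) := by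
    have hd' : HasDerivAt (fun r => F (t + r) - F (t - r)) (2 * d) 0 := by
      have h1 : HasDerivAt (fun r => F (t + r)) d 0 :=
        HasDerivAt.comp_const_add t 0 (by simpa using hd)
      have h2 : HasDerivAt (fun r => F (t - r)) (-d) 0 :=
        HasDerivAt.comp_const_sub t 0 (by simpa using hd)
      exact (h1.sub h2).congr_deriv (by ring)
    have := (hasDerivAt_iff_tendsto_slope.1 hd').mono_left
      (nhdsWithin_mono 0 (fun r (hr : 0 < r) => hr.ne'))
    refine ((this.div_const 2).congr fun r => ?_).trans_eq (by simp)
    simp [slope_def_field]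
    rw [div_div, mul_comm r]
  refine (ENNReal.tendsto_ofReal hq).congr' ?_
  filter_upwards [self_mem_nhdsWithin] with r hr
  have hr : 0 < r := hr
  rw [Real.volume_closedBall, closedBall_eq_Icc, measure_Icc_eq_of_continuous_cdf hF h,
    ENNReal.ofReal_div_of_pos (by positivity)]

/-- Compare tails `Ioi u` by the fundamental theorem of calculus. At `a` only continuity of `F` is
used, which allows `ρ` to be unbounded there. -/
lemma eq_withDensity_of_hasDerivAt {ρ : ℝ → ℝ} (hF : Continuous F) (h : ∀ u, μ.real (Iic u) = F u)
    (hρ0 : ∀ t, 0 ≤ ρ t) {a : ℝ} (hFa : ∀ t ≤ a, F t = 0) (hρa : ∀ t ≤ a, ρ t = 0)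
    (hd : ∀ t, a < t → HasDerivAt F (ρ t) t) :
    μ = volume.withDensity fun t => ENNReal.ofReal (ρ t) := by
  have hc : (cdf μ : ℝ → ℝ) = F := funext fun u => by rw [cdf_eq_real, h]
  have hlim : Tendsto F atTop (𝓝 1) := hc ▸ tendsto_cdf_atTop μ
  have key : ∀ u, a ≤ u → (volume.withDensity fun t => ENNReal.ofReal (ρ t)) (Ioi u) = μ (Ioi u) := by
    intro u hu
    have hd' : ∀ t ∈ Ioi u, HasDerivAt F (ρ t) t := fun t ht => hd t (hu.trans_lt ht)
    rw [withDensity_apply _ measurableSet_Ioi, ← ofReal_integral_eq_lintegral_ofReal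
      (integrableOn_Ioi_deriv_of_nonneg hF.continuousWithinAt hd' (fun t _ => hρ0 t) hlim)
      (ae_of_all _ hρ0),
      integral_Ioi_of_hasDerivAt_of_nonneg hF.continuousWithinAt hd' (fun t _ => hρ0 t) hlim,
      ← h u, ← probReal_compl_eq_one_sub measurableSet_Iic, compl_Iic, ofReal_measureReal]
  have key' : ∀ u, (volume.withDensity fun t => ENNReal.ofReal (ρ t)) (Ioi u) = μ (Ioi u) := by
    intro u
    rcases le_or_gt a u with hu | hu
    · exact key u hu
    · rw [← Ioc_union_Ioi_eq_Ioi hu.le, measure_union (Ioc_disjoint_Ioi le_rfl) measurableSet_Ioi,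
        measure_union (Ioc_disjoint_Ioi le_rfl) measurableSet_Ioi, key a le_rfl]
      congr 1
      rw [withDensity_apply _ measurableSet_Ioc, setLIntegral_congr_fun measurableSet_Ioc
        (g := fun _ => 0) (fun t ht => by simp [hρa t ht.2])]
      have : μ (Icc u a) = 0 := by
        rw [measure_Icc_eq_of_continuous_cdf hF h, hFa u hu.le, hFa a le_rfl]; simp
      simpa using (measure_mono_null Ioc_subset_Icc_self this).symm
  have htot : (volume.withDensity fun t => ENNReal.ofReal (ρ t)) univ = 1 := by
    have := key a le_rfl
    have h1 : μ (Ioi a) = 1 := by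
      rw [← compl_Iic, prob_compl_eq_one_iff measurableSet_Iic, ← measureReal_eq_zero_iff, h, hFa a le_rfl]
    rw [← Iic_union_Ioi (a := a), measure_union (Iic_disjoint_Ioi le_rfl) measurableSet_Ioi, this, h1, withDensity_apply _ measurableSet_Iic,
        setLIntegral_congr_fun measurableSet_Iic
        (g := fun _ => 0) (fun t ht => by simp [hρa t ht])]
    simp
  have : IsProbabilityMeasure (volume.withDensity fun t => ENNReal.ofReal (ρ t)) := ⟨htot⟩
  refine Measure.ext_of_Iic _ _ fun u => ?_
  rw [← compl_Ioi, prob_compl_eq_one_sub measurableSet_Ioi, prob_compl_eq_one_sub measurableSet_Ioi,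
    key']

/-- The right half `(a, a + r]` of the ball already has mass at least `r ρ(a + r)`, so the ratio is
at least `ρ(a + r) / 2`. -/
lemma pointDensity_eq_top_of_antitoneOn {ν : Measure ℝ} {ρ : ℝ → ℝ} {a : ℝ}
    (h : ν = volume.withDensity fun t => ENNReal.ofReal (ρ t))
    (hρ : AntitoneOn ρ (Ioi a)) (hlim : Tendsto ρ (𝓝[>] a) atTop) : pointDensity ν a = ⊤ := by
  refine Tendsto.limsup_eq ?_
  have h1 : Tendsto (fun r : ℝ => ENNReal.ofReal (ρ (a + r) / 2)) (𝓝[>] 0) (𝓝 ⊤) := by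
    refine ENNReal.tendsto_ofReal_atTop.comp ((Tendsto.comp hlim ?_).atTop_div_const two_pos)
    refine tendsto_nhdsWithin_iff.2 ⟨?_, ?_⟩
    · exact (Continuous.tendsto' (by fun_prop) 0 a (by simp)).mono_left nhdsWithin_le_nhds
    · filter_upwards [self_mem_nhdsWithin] with r hr
      simpa using hr
  refine tendsto_nhds_top_mono h1 ?_
  filter_upwards [self_mem_nhdsWithin] with r hr
  have hr : 0 < r := hr
  have h2 : ENNReal.ofReal (ρ (a + r)) * ENNReal.ofReal r ≤ ν (Metric.closedBall a r) := by
    calc ENNReal.ofReal (ρ (a + r)) * ENNReal.ofReal r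
        = ∫⁻ _ in Ioc a (a + r), ENNReal.ofReal (ρ (a + r)) := by simp
      _ ≤ ∫⁻ t in Ioc a (a + r), ENNReal.ofReal (ρ t) := by
          refine setLIntegral_mono' measurableSet_Ioc fun t ht => ENNReal.ofReal_le_ofReal ?_
          exact hρ ht.1 (by simpa using hr) ht.2
      _ = ν (Ioc a (a + r)) := by rw [h, withDensity_apply _ measurableSet_Ioc]
      _ ≤ ν (Metric.closedBall a r) := by
          refine measure_mono ?_
          rw [closedBall_eq_Icc]
          exact fun t ht => ⟨by linarith [ht.1], ht.2⟩
  rw [Real.volume_closedBall, ENNReal.le_div_iff_mul_le (by left; simpa using hr)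
    (by left; exact ENNReal.ofReal_ne_top)]
  refine le_trans (le_of_eq ?_) h2
  rw [← ENNReal.ofReal_mul' (by positivity), ← ENNReal.ofReal_mul' hr.le]
  congr 1
  ring

end DistributionFunction

/-! ### Product densities and independence of columns. -/

lemma pi_withDensity_ofReal {ι : Type*} [Fintype ι] (ρ : ι → ℝ → ℝ) (hρ0 : ∀ i t, 0 ≤ ρ i t)
    (hρ : ∀ i, Integrable (ρ i)) :
    Measure.pi (fun i => volume.withDensity fun t => ENNReal.ofReal (ρ i t)) =
      volume.withDensity fun z => ∏ i, ENNReal.ofReal (ρ i (z i)) := by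
  have : ∀ i, IsFiniteMeasure (volume.withDensity fun t => ENNReal.ofReal (ρ i t)) := fun i =>
    isFiniteMeasure_withDensity_ofReal (hρ i).2
  refine Measure.pi_eq fun S hS => ?_
  have hint : ∀ i, Integrable ((S i).indicator (ρ i)) := fun i => (hρ i).indicator (hS i)
  have h0 : ∀ i t, 0 ≤ (S i).indicator (ρ i) t := fun i t => indicator_nonneg (fun t _ => hρ0 i t) t
  have hprod : ∀ z, (univ.pi S).indicator (fun z => ∏ i, ENNReal.ofReal (ρ i (z i))) z =
      ENNReal.ofReal (∏ i, (S i).indicator (ρ i) (z i)) := by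
    intro z
    rw [ENNReal.ofReal_prod_of_nonneg fun i _ => h0 i _]
    by_cases hz : z ∈ univ.pi S
    · rw [indicator_of_mem hz]
      refine Finset.prod_congr rfl fun i _ => ?_
      rw [indicator_of_mem (hz i (mem_univ i))]
    · rw [indicator_of_notMem hz]
      obtain ⟨i, hi⟩ : ∃ i, z i ∉ S i := by simpa [Set.mem_pi] using hz
      exact (Finset.prod_eq_zero (Finset.mem_univ i) (by simp [indicator_of_notMem hi])).symm
  rw [withDensity_apply _ (MeasurableSet.univ_pi hS),
    ← lintegral_indicator (MeasurableSet.univ_pi hS)]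
  simp_rw [hprod]
  have hi : Integrable (fun z : ι → ℝ => ∏ i, (S i).indicator (ρ i) (z i)) :=
    Integrable.fintype_prod hint
  rw [← ofReal_integral_eq_lintegral_ofReal hi
    (ae_of_all _ fun z => Finset.prod_nonneg fun i _ => h0 i _),
    integral_fintype_prod_volume_eq_prod, ENNReal.ofReal_prod_of_nonneg
      fun i _ => integral_nonneg (h0 i)]
  refine Finset.prod_congr rfl fun i _ => ?_
  rw [ofReal_integral_eq_lintegral_ofReal (hint i) (ae_of_all _ (h0 i)),
    withDensity_apply _ (hS i), ← lintegral_indicator (hS i)]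
  congr 1; ext t
  by_cases ht : t ∈ S i <;> simp [ht]

/-- Currying turns the product law of all entries into a product over `j` of the laws of the
columns. -/
lemma iIndepFun_pi_of_prod {Ω ι κ : Type*} [MeasurableSpace Ω] {P : Measure Ω}
    [IsProbabilityMeasure P] {s : ι → κ → Ω → ℝ} (hs : ∀ t j, Measurable (s t j))
    (h : iIndepFun (fun p : ι × κ => s p.1 p.2) P) :
    iIndepFun (fun j ω t => s t j ω) P := by
  have hp : ∀ t j, IsProbabilityMeasure (P.map (s t j)) := fun t j =>
    Measure.isProbabilityMeasure_map (hs t j).aemeasurable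
  have h1 : iIndepFun (fun (p : (_ : κ) × ι) ω => s p.2 p.1 ω) P :=
    h.precomp (g := fun p : (_ : κ) × ι => (p.2, p.1)) (by
      rintro ⟨a, b⟩ ⟨c, d⟩ hh; simp at hh; simp [hh])
  have h2 : ∀ j, iIndepFun (fun t ω => s t j ω) P := fun j =>
    h.precomp (g := fun t : ι => (t, j)) (by intro a b hh; simpa using hh)
  have : (MeasurableEquiv.piCurry fun (_ : κ) (_ : ι) => ℝ) ∘
      (fun ω (p : (_ : κ) × ι) => s p.2 p.1 ω) = fun ω j t => s t j ω := by
    ext; simp [Sigma.curry]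
  rw [iIndepFun_iff_map_fun_eq_infinitePi_map (by fun_prop), ← this,
    ← Measure.map_map (by fun_prop) (by fun_prop),
    (iIndepFun_iff_map_fun_eq_infinitePi_map (by fun_prop)).1 h1,
    Measure.infinitePi_map_piCurry (fun j t => P.map (s t j))]
  congr 1
  ext1 j
  rw [(iIndepFun_iff_map_fun_eq_infinitePi_map (by fun_prop)).1 (h2 j)]

/-! ### Closed form of the ratio distribution and its density. -/

/-- The distribution function of `a + W / S`, where `W` and `S` are independent maximally skewed
`α`-stable variables, `S` of unit scale and `W` of scale `K ^ (1 / α)`. -/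
noncomputable def stableRatioCDF (α K a u : ℝ) : ℝ :=
  (1 - 2 / (π * α) * arctan (tan (π * α / 2) * (K - max (u - a) 0 ^ α) / (K + max (u - a) 0 ^ α))) / 2

/-- The derivative of `stableRatioCDF`. -/
noncomputable def stableRatioPDF (α K a t : ℝ) : ℝ :=
  if t ≤ a then 0 else
    2 * tan (π * α / 2) * K / π * ((t - a) ^ (α - 1) *
      ((K + (t - a) ^ α) ^ 2 + tan (π * α / 2) ^ 2 * (K - (t - a) ^ α) ^ 2)⁻¹)

section StableRatio

variable {α K a : ℝ}

lemma tan_pi_mul_div_two_pos (hα0 : 0 < α) (hα1 : α < 1) : 0 < tan (π * α / 2) :=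
  tan_pos_of_pos_of_lt_pi_div_two (by positivity) (by nlinarith [pi_pos])

lemma tan_pi_mul_div_two_le_one (hα0 : 0 < α) (hα1 : α ≤ 1 / 2) : tan (π * α / 2) ≤ 1 := by
  rw [← tan_pi_div_four]
  exact strictMonoOn_tan.monotoneOn ⟨by nlinarith [pi_pos], by nlinarith [pi_pos]⟩
    ⟨by linarith [pi_pos], by linarith [pi_pos]⟩ (by nlinarith [pi_pos])

lemma continuous_stableRatioCDF (hα0 : 0 < α) (hK : 0 < K) : Continuous (stableRatioCDF α K a) := by
  have hw : Continuous fun u : ℝ => max (u - a) 0 ^ α :=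
    Continuous.rpow_const (by fun_prop) fun _ => Or.inr hα0.le
  have hne : ∀ u : ℝ, K + max (u - a) 0 ^ α ≠ 0 := fun u => by positivity
  unfold stableRatioCDF
  have : Continuous fun u : ℝ =>
      tan (π * α / 2) * (K - max (u - a) 0 ^ α) / (K + max (u - a) 0 ^ α) :=
    (continuous_const.mul (continuous_const.sub hw)).div (continuous_const.add hw) hne
  fun_prop

lemma stableRatioCDF_of_le (hα0 : 0 < α) (hα1 : α < 1) (hK : 0 < K) {u : ℝ} (hu : u ≤ a) :
    stableRatioCDF α K a u = 0 := by
  have := pi_pos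
  rw [stableRatioCDF, max_eq_right (by linarith), zero_rpow hα0.ne', sub_zero, add_zero,
    mul_div_assoc, div_self hK.ne', mul_one, arctan_tan (by nlinarith) (by nlinarith)]
  field_simp
  ring

lemma hasDerivAt_stableRatioCDF (hα0 : 0 < α) (hK : 0 < K) {t : ℝ} (ht : a < t) :
    HasDerivAt (stableRatioCDF α K a) (stableRatioPDF α K a t) t := by
  have hta : 0 < t - a := sub_pos.2 ht
  have hw : HasDerivAt (fun u : ℝ => (u - a) ^ α) (α * (t - a) ^ (α - 1)) t := by
    simpa using ((hasDerivAt_id' t).sub_const a).rpow_const (p := α) (Or.inl hta.ne')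
  set τ := tan (π * α / 2) with hτ
  have hwp : 0 < (t - a) ^ α := rpow_pos_of_pos hta α
  have hd := ((((((hw.const_sub K).const_mul τ).div (hw.const_add K) (by positivity)).arctan).const_mul
    (2 / (π * α))).const_sub 1).div_const 2
  refine (hd.congr_of_eventuallyEq ?_).congr_deriv ?_
  · filter_upwards [Ioi_mem_nhds ht] with u hu
    simp only [stableRatioCDF, max_eq_left (sub_nonneg.2 (le_of_lt (show a < u from hu))), ← hτ,
      Pi.div_apply]
  · rw [stableRatioPDF, if_neg ht.not_ge, ← hτ]
    have h1 : (K + (t - a) ^ α) ^ 2 + τ ^ 2 * (K - (t - a) ^ α) ^ 2 ≠ 0 := by positivity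
    have h2 : K + (t - a) ^ α ≠ 0 := by positivity
    have := pi_pos.ne'
    simp only [Pi.div_apply]
    generalize (t - a) ^ (α - 1) = y at *
    generalize (t - a) ^ α = w at *
    have h3 : (1 : ℝ) + (τ * (K - w) / (K + w)) ^ 2 =
        ((K + w) ^ 2 + τ ^ 2 * (K - w) ^ 2) / (K + w) ^ 2 := by
      field_simp
    simp only [h3]
    field_simp
    ring

lemma stableRatioPDF_of_le {t : ℝ} (ht : t ≤ a) : stableRatioPDF α K a t = 0 := if_pos ht

lemma stableRatioPDF_pos (hα0 : 0 < α) (hα1 : α < 1) (hK : 0 < K) {t : ℝ} (ht : a < t) :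
    0 < stableRatioPDF α K a t := by
  have hta : 0 < t - a := sub_pos.2 ht
  have := tan_pi_mul_div_two_pos hα0 hα1
  rw [stableRatioPDF, if_neg ht.not_ge]
  positivity

lemma stableRatioPDF_nonneg (hα0 : 0 < α) (hα1 : α < 1) (hK : 0 < K) (t : ℝ) :
    0 ≤ stableRatioPDF α K a t := by
  rcases le_or_gt t a with h | h
  · exact (stableRatioPDF_of_le h).ge
  · exact (stableRatioPDF_pos hα0 hα1 hK h).le

lemma measurable_stableRatioPDF : Measurable (stableRatioPDF α K a) := by
  unfold stableRatioPDF
  exact Measurable.ite measurableSet_Iic measurable_const (by fun_prop)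

/-- Both factors decrease in `t`: the power because `α < 1`, the inverse because its denominator
increases. The latter uses `τ ≤ 1`, hence `α ≤ 1/2`. -/
lemma antitoneOn_stableRatioPDF (hα0 : 0 < α) (hα1 : α ≤ 1 / 2) (hK : 0 < K) :
    AntitoneOn (stableRatioPDF α K a) (Ioi a) := by
  intro t ht u hu htu
  have hta : 0 < t - a := sub_pos.2 ht
  have hua : 0 < u - a := sub_pos.2 hu
  have hτ := tan_pi_mul_div_two_pos hα0 (by linarith)
  have hτ1 := tan_pi_mul_div_two_le_one hα0 hα1
  rw [stableRatioPDF, stableRatioPDF, if_neg (sub_pos.1 hta).not_ge,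
    if_neg (sub_pos.1 hua).not_ge]
  have h1 : (u - a) ^ (α - 1) ≤ (t - a) ^ (α - 1) :=
    rpow_le_rpow_of_nonpos hta (by linarith) (by linarith)
  have h2 : (t - a) ^ α ≤ (u - a) ^ α := rpow_le_rpow hta.le (by linarith) hα0.le
  have h3 : 0 < (t - a) ^ α := by positivity
  have h4 : 0 ≤ (t - a) ^ (α - 1) := by positivity
  set τ := tan (π * α / 2)
  generalize (t - a) ^ α = v at *
  generalize (u - a) ^ α = w at *
  have h5 : (K + v) ^ 2 + τ ^ 2 * (K - v) ^ 2 ≤ (K + w) ^ 2 + τ ^ 2 * (K - w) ^ 2 := by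
    -- The factored difference of the two sides of `h5`.
    have : 0 ≤ (w - v) * ((1 - τ ^ 2) * (2 * K) + (1 + τ ^ 2) * (w + v)) := by
      have : τ ^ 2 ≤ 1 := pow_le_one₀ hτ.le hτ1
      have : 0 ≤ 1 - τ ^ 2 := by linarith
      have : 0 ≤ w - v := by linarith
      have : 0 ≤ w + v := by linarith
      positivity
    nlinarith
  gcongr

lemma tendsto_stableRatioPDF (hα0 : 0 < α) (hα1 : α < 1) (hK : 0 < K) :
    Tendsto (stableRatioPDF α K a) (𝓝[>] a) atTop := by
  have hτ := tan_pi_mul_div_two_pos hα0 hα1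
  have hsub : Tendsto (fun t => t - a) (𝓝[>] a) (𝓝[>] 0) := by
    refine tendsto_nhdsWithin_iff.2 ⟨?_, ?_⟩
    · exact (Continuous.tendsto' (by fun_prop) a 0 (by simp)).mono_left nhdsWithin_le_nhds
    · filter_upwards [self_mem_nhdsWithin] with r hr
      simpa using hr
  have h1 : Tendsto (fun t => (t - a) ^ (α - 1)) (𝓝[>] a) atTop :=
    (tendsto_rpow_neg_nhdsGT_zero (by linarith)).comp hsub
  have h2 : Tendsto (fun t => (t - a) ^ α) (𝓝[>] a) (𝓝 0) := by
    have : Tendsto (fun x : ℝ => x ^ α) (𝓝[>] 0) (𝓝 0) := by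
      have := (continuousAt_rpow_const 0 α (Or.inr hα0.le)).tendsto
      rw [zero_rpow hα0.ne'] at this
      exact this.mono_left nhdsWithin_le_nhds
    exact this.comp hsub
  set τ := tan (π * α / 2) with hτd
  have h3 : Tendsto (fun t => ((K + (t - a) ^ α) ^ 2 + τ ^ 2 * (K - (t - a) ^ α) ^ 2)⁻¹) (𝓝[>] a)
      (𝓝 ((K + 0) ^ 2 + τ ^ 2 * (K - 0) ^ 2)⁻¹) :=
    (((h2.const_add K).pow 2).add (((h2.const_sub K).pow 2).const_mul _)).inv₀ (by positivity)
  have h4 := (h1.atTop_mul_pos (by positivity) h3).const_mul_atTop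
    (show 0 < 2 * τ * K / π by positivity)
  refine h4.congr' ?_
  filter_upwards [self_mem_nhdsWithin] with t ht
  rw [stableRatioPDF, if_neg (show a < t from ht).not_ge]

end StableRatio

/-! ### The law of the ratio statistic. -/

section RatioStatistic

variable {Ω ι : Type*} [MeasurableSpace Ω] {P : Measure Ω} [IsProbabilityMeasure P] [Fintype ι]
  {α : ℝ} {X : ι → Ω → ℝ}

lemma ae_pos_of_isMaxSkewedStable (hα : 0 < α) (hα1 : α < 1) (hX : ∀ t, Measurable (X t))
    (hlaw : ∀ t, IsMaxSkewedStable α (P.map (X t))) (hind : iIndepFun X P) (i : ι) :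
    ∀ᵐ ω ∂P, 0 < X i ω := by
  classical
  have := ae_sum_pos_of_isMaxSkewedStable hα hα1 hX hlaw hind (fun t => if t = i then 1 else 0)
    (fun t => by split_ifs <;> simp) ⟨i, by simp⟩
  simpa using this

lemma sum_sub_mul_eq_mul_ratio_sub [DecidableEq ι] (x y : ι → ℝ) (i : ι) (hy : 0 < y i) (u : ℝ) :
    ∑ t, (x t - if t = i then u else 0) * y t = y i * ((∑ t, x t * y t) / y i - u) := by
  simp only [sub_mul, Finset.sum_sub_distrib, ite_mul, zero_mul, Finset.sum_ite_eq',
    Finset.mem_univ, if_true]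
  field_simp

/-- Subtracting `x i` from the ratio amounts to setting the `i`-th coefficient to `0`; the remaining
ones are nonnegative and not all zero. -/
lemma ae_lt_ratio_of_isMaxSkewedStable (hα : 0 < α) (hα1 : α < 1) (hX : ∀ t, Measurable (X t))
    (hlaw : ∀ t, IsMaxSkewedStable α (P.map (X t))) (hind : iIndepFun X P) {i : ι} {x : ι → ℝ}
    (hx : ∀ t, 0 ≤ x t) (hx' : ∃ t, t ≠ i ∧ 0 < x t) :
    ∀ᵐ ω ∂P, x i < (∑ t, x t * X t ω) / X i ω := by
  classical
  obtain ⟨t₀, ht₀, hpos⟩ := hx'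
  filter_upwards [ae_pos_of_isMaxSkewedStable hα hα1 hX hlaw hind i,
    ae_sum_pos_of_isMaxSkewedStable hα hα1 hX hlaw hind (fun t => x t - if t = i then x i else 0)
      (fun t => by
        split_ifs with h
        · simp [h]
        · simpa using hx t) ⟨t₀, by simpa [ht₀] using hpos⟩] with ω h1 h2
  rw [sum_sub_mul_eq_mul_ratio_sub x (fun t => X t ω) i h1] at h2
  exact sub_pos.1 (pos_of_mul_pos_right h2 h1.le)

lemma measureReal_ratio_le_of_isMaxSkewedStable [DecidableEq ι] (hα : 0 < α) (hα1 : α < 1)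
    (hX : ∀ t, Measurable (X t))
    (hlaw : ∀ t, IsMaxSkewedStable α (P.map (X t))) (hind : iIndepFun X P) {i : ι} {x : ι → ℝ}
    (hx : ∀ t, 0 ≤ x t) (hx' : ∃ t, t ≠ i ∧ 0 < x t) (u : ℝ) :
    (P.map fun ω => (∑ t, x t * X t ω) / X i ω).real (Iic u) =
      stableRatioCDF α (∑ t ∈ Finset.univ.erase i, x t ^ α) (x i) u := by
  have hm : Measurable fun ω => (∑ t, x t * X t ω) / X i ω :=
    (Finset.measurable_sum _ fun t _ => (hX t).const_mul _).div (hX i)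
  have := Measure.isProbabilityMeasure_map (μ := P) hm.aemeasurable
  obtain ⟨t₀, ht₀, hpos⟩ := hx'
  have hK : 0 < ∑ t ∈ Finset.univ.erase i, x t ^ α :=
    Finset.sum_pos' (fun t _ => rpow_nonneg (hx t) _) ⟨t₀, by simp [ht₀], by positivity⟩
  refine measureReal_Iic_eq_of_integral_sign (continuous_stableRatioCDF hα hK) (fun u => ?_) u
  rw [integral_map hm.aemeasurable
    (f := fun z => Real.sign (z - u))
    (measurable_real_sign.comp (measurable_id.sub_const u)).aestronglyMeasurable]
  have hsgn : ∀ᵐ ω ∂P, Real.sign ((∑ t, x t * X t ω) / X i ω - u) =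
      Real.sign (∑ t, (x t - if t = i then u else 0) * X t ω) := by
    filter_upwards [ae_pos_of_isMaxSkewedStable hα hα1 hX hlaw hind i] with ω h1
    rw [sum_sub_mul_eq_mul_ratio_sub x (fun t => X t ω) i h1]
    rcases lt_trichotomy ((∑ t, x t * X t ω) / X i ω - u) 0 with h | h | h
    · rw [sign_of_neg h, sign_of_neg (mul_neg_of_pos_of_neg h1 h)]
    · simp [h]
    · rw [sign_of_pos h, sign_of_pos (mul_pos h1 h)]
  have hA : ∑ t, |x t - if t = i then u else 0| ^ α =
      ∑ t ∈ Finset.univ.erase i, x t ^ α + |x i - u| ^ α := by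
    rw [← Finset.sum_erase_add _ _ (Finset.mem_univ i), if_pos rfl]
    congr 1
    refine Finset.sum_congr rfl fun t ht => ?_
    rw [if_neg (Finset.ne_of_mem_erase ht), sub_zero, abs_of_nonneg (hx t)]
  have hB : ∑ t, Real.sign (x t - if t = i then u else 0) * |x t - if t = i then u else 0| ^ α =
      ∑ t ∈ Finset.univ.erase i, x t ^ α + Real.sign (x i - u) * |x i - u| ^ α := by
    rw [← Finset.sum_erase_add _ _ (Finset.mem_univ i), if_pos rfl]
    congr 1
    refine Finset.sum_congr rfl fun t ht => ?_
    rw [if_neg (Finset.ne_of_mem_erase ht), sub_zero, abs_of_nonneg (hx t)]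
    rcases (hx t).eq_or_lt with h | h
    · simp [← h, hα.ne']
    · rw [sign_of_pos h, one_mul]
  rw [integral_congr_ae hsgn, integral_sign_sum_of_isMaxSkewedStable hα hX hlaw hind _
    (by rw [hA]; positivity), hA, hB, stableRatioCDF]
  generalize ∑ t ∈ Finset.univ.erase i, x t ^ α = K at *
  -- Below `x i` both arctangent quotients equal `tan(πα/2)`; from `x i` on, the `i`-th coefficient
  -- is nonpositive and enters with a minus sign.
  rcases lt_or_ge u (x i) with h | h
  · rw [max_eq_right (by linarith), zero_rpow hα.ne', sign_of_pos (by linarith), one_mul,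
      mul_div_assoc (tan _), mul_div_assoc (tan _), div_self (by positivity), sub_zero, add_zero,
      div_self hK.ne']
    ring
  · have : Real.sign (x i - u) * |x i - u| ^ α = -(u - x i) ^ α := by
      rcases h.eq_or_lt with h' | h'
      · simp [h', hα.ne']
      · rw [sign_of_neg (by linarith), abs_of_neg (by linarith)]; simp
    rw [this, abs_of_nonpos (by linarith), max_eq_left (by linarith), neg_sub, ← sub_eq_add_neg]
    ring

end RatioStatistic

lemma iIndepFun_column {Ω : Type*} [MeasurableSpace Ω] {P : Measure Ω} {N M : ℕ}
    {s : Fin N → Fin M → Ω → ℝ} (hindep : iIndepFun (fun p : Fin N × Fin M => s p.1 p.2) P)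
    (j : Fin M) : iIndepFun (fun t => s t j) P :=
  hindep.precomp (g := fun t => (t, j)) fun a b h => by simpa using h

/-! ### Density of the ratios, joint density and maximization of the likelihood. -/

section Likelihood

variable {Ω : Type*} [MeasurableSpace Ω] {P : Measure Ω} [IsProbabilityMeasure P] {N M : ℕ} {α : ℝ}
  {s : Fin N → Fin M → Ω → ℝ} {i : Fin N} {x : Fin N → ℝ}

lemma measurable_ratioStat (hmeas : ∀ t j, Measurable (s t j)) (x : Fin N → ℝ) (i : Fin N)
    (j : Fin M) : Measurable (ratioStat s x i j) :=
  (Finset.measurable_sum _ fun t _ => (hmeas t j).const_mul _).div (hmeas i j)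

lemma sum_erase_rpow_pos_of_mem_admissibleSignals (hx : x ∈ admissibleSignals i) :
    0 < ∑ t ∈ Finset.univ.erase i, x t ^ α := by
  obtain ⟨hx0, t₀, ht₀, hpos⟩ := hx
  exact Finset.sum_pos' (fun t _ => rpow_nonneg (hx0 t) _) ⟨t₀, by simp [ht₀], by positivity⟩

lemma measureReal_ratioStat_Iic (hα0 : 0 < α) (hα1 : α < 1) (hmeas : ∀ t j, Measurable (s t j))
    (hlaw : ∀ t j, IsMaxSkewedStable α (P.map (s t j)))
    (hindep : iIndepFun (fun p : Fin N × Fin M => s p.1 p.2) P) (hx : x ∈ admissibleSignals i)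
    (j : Fin M) (u : ℝ) : (P.map (ratioStat s x i j)).real (Iic u) =
      stableRatioCDF α (∑ t ∈ Finset.univ.erase i, x t ^ α) (x i) u :=
  measureReal_ratio_le_of_isMaxSkewedStable hα0 hα1 (fun t => hmeas t j) (fun t => hlaw t j)
    (iIndepFun_column hindep j) hx.1 hx.2 u

lemma hasDerivAt_stableRatioCDF_of_ne {K a : ℝ} (hα0 : 0 < α) (hα1 : α < 1) (hK : 0 < K) {t : ℝ}
    (ht : t ≠ a) : HasDerivAt (stableRatioCDF α K a) (stableRatioPDF α K a t) t := by
  rcases ht.lt_or_gt with h | h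
  · rw [stableRatioPDF_of_le h.le]
    refine (hasDerivAt_const t (0 : ℝ)).congr_of_eventuallyEq ?_
    filter_upwards [Iio_mem_nhds h] with u hu
    exact stableRatioCDF_of_le hα0 hα1 hK (le_of_lt hu)
  · exact hasDerivAt_stableRatioCDF hα0 hK h

lemma map_ratioStat_eq_withDensity (hα0 : 0 < α) (hα1 : α < 1) (hmeas : ∀ t j, Measurable (s t j))
    (hlaw : ∀ t j, IsMaxSkewedStable α (P.map (s t j)))
    (hindep : iIndepFun (fun p : Fin N × Fin M => s p.1 p.2) P) (hx : x ∈ admissibleSignals i)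
    (j : Fin M) : P.map (ratioStat s x i j) = volume.withDensity fun t =>
      ENNReal.ofReal (stableRatioPDF α (∑ t ∈ Finset.univ.erase i, x t ^ α) (x i) t) := by
  have hK := sum_erase_rpow_pos_of_mem_admissibleSignals (α := α) hx
  have := Measure.isProbabilityMeasure_map (μ := P) (measurable_ratioStat hmeas x i j).aemeasurable
  exact eq_withDensity_of_hasDerivAt (continuous_stableRatioCDF hα0 hK)
    (measureReal_ratioStat_Iic hα0 hα1 hmeas hlaw hindep hx j)
    (stableRatioPDF_nonneg hα0 hα1 hK) (fun _ => stableRatioCDF_of_le hα0 hα1 hK)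
    (fun _ => stableRatioPDF_of_le) fun _ => hasDerivAt_stableRatioCDF hα0 hK

lemma ratioDensity_of_ne (hα0 : 0 < α) (hα1 : α < 1) (hmeas : ∀ t j, Measurable (s t j))
    (hlaw : ∀ t j, IsMaxSkewedStable α (P.map (s t j)))
    (hindep : iIndepFun (fun p : Fin N × Fin M => s p.1 p.2) P) (hx : x ∈ admissibleSignals i)
    (j : Fin M) {t : ℝ} (ht : t ≠ x i) : ratioDensity P s x i j t =
      ENNReal.ofReal (stableRatioPDF α (∑ t ∈ Finset.univ.erase i, x t ^ α) (x i) t) := by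
  have hK := sum_erase_rpow_pos_of_mem_admissibleSignals (α := α) hx
  have := Measure.isProbabilityMeasure_map (μ := P) (measurable_ratioStat hmeas x i j).aemeasurable
  exact pointDensity_eq_of_hasDerivAt (continuous_stableRatioCDF hα0 hK)
    (measureReal_ratioStat_Iic hα0 hα1 hmeas hlaw hindep hx j)
    (hasDerivAt_stableRatioCDF_of_ne hα0 hα1 hK ht)

lemma ratioDensity_self (hα0 : 0 < α) (hα1 : α ≤ 1 / 2) (hmeas : ∀ t j, Measurable (s t j))
    (hlaw : ∀ t j, IsMaxSkewedStable α (P.map (s t j)))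
    (hindep : iIndepFun (fun p : Fin N × Fin M => s p.1 p.2) P) (hx : x ∈ admissibleSignals i)
    (j : Fin M) : ratioDensity P s x i j (x i) = ⊤ := by
  have hK := sum_erase_rpow_pos_of_mem_admissibleSignals (α := α) hx
  exact pointDensity_eq_top_of_antitoneOn
    (map_ratioStat_eq_withDensity hα0 (by linarith) hmeas hlaw hindep hx j)
    (antitoneOn_stableRatioPDF hα0 hα1 hK) (tendsto_stableRatioPDF hα0 (by linarith) hK)

lemma ratioDensity_eq_zero_of_lt (hα0 : 0 < α) (hα1 : α < 1) (hmeas : ∀ t j, Measurable (s t j))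
    (hlaw : ∀ t j, IsMaxSkewedStable α (P.map (s t j)))
    (hindep : iIndepFun (fun p : Fin N × Fin M => s p.1 p.2) P) (hx : x ∈ admissibleSignals i)
    (j : Fin M) {t : ℝ} (ht : t < x i) : ratioDensity P s x i j t = 0 := by
  rw [ratioDensity_of_ne hα0 hα1 hmeas hlaw hindep hx j ht.ne, stableRatioPDF_of_le ht.le,
    ENNReal.ofReal_zero]

lemma ratioDensity_ne_zero_of_le (hα0 : 0 < α) (hα1 : α ≤ 1 / 2) (hmeas : ∀ t j, Measurable (s t j))
    (hlaw : ∀ t j, IsMaxSkewedStable α (P.map (s t j)))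
    (hindep : iIndepFun (fun p : Fin N × Fin M => s p.1 p.2) P) (hx : x ∈ admissibleSignals i)
    (j : Fin M) {t : ℝ} (ht : x i ≤ t) : ratioDensity P s x i j t ≠ 0 := by
  have hK := sum_erase_rpow_pos_of_mem_admissibleSignals (α := α) hx
  rcases ht.eq_or_lt with rfl | h
  · simp [ratioDensity_self hα0 hα1 hmeas hlaw hindep hx j]
  · rw [ratioDensity_of_ne hα0 (by linarith) hmeas hlaw hindep hx j h.ne']
    simpa using stableRatioPDF_pos hα0 (by linarith) hK h

lemma antitoneOn_ratioDensity (hα0 : 0 < α) (hα1 : α ≤ 1 / 2) (hmeas : ∀ t j, Measurable (s t j))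
    (hlaw : ∀ t j, IsMaxSkewedStable α (P.map (s t j)))
    (hindep : iIndepFun (fun p : Fin N × Fin M => s p.1 p.2) P) (hx : x ∈ admissibleSignals i)
    (j : Fin M) : AntitoneOn (ratioDensity P s x i j) (Ici (x i)) := by
  have hK := sum_erase_rpow_pos_of_mem_admissibleSignals (α := α) hx
  intro t ht u hu htu
  rcases (show x i ≤ t from ht).eq_or_lt with h | h
  · rw [← h, ratioDensity_self hα0 hα1 hmeas hlaw hindep hx j]
    exact le_top
  · have h' := h.trans_le htu
    rw [ratioDensity_of_ne hα0 (by linarith) hmeas hlaw hindep hx j h.ne',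
      ratioDensity_of_ne hα0 (by linarith) hmeas hlaw hindep hx j h'.ne']
    exact ENNReal.ofReal_le_ofReal (antitoneOn_stableRatioPDF hα0 hα1 hK h h' htu)

lemma tendsto_ratioDensity (hα0 : 0 < α) (hα1 : α < 1) (hmeas : ∀ t j, Measurable (s t j))
    (hlaw : ∀ t j, IsMaxSkewedStable α (P.map (s t j)))
    (hindep : iIndepFun (fun p : Fin N × Fin M => s p.1 p.2) P) (hx : x ∈ admissibleSignals i)
    (j : Fin M) : Tendsto (ratioDensity P s x i j) (𝓝[>] (x i)) (𝓝 ⊤) := by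
  have hK := sum_erase_rpow_pos_of_mem_admissibleSignals (α := α) hx
  refine (ENNReal.tendsto_ofReal_atTop.comp (tendsto_stableRatioPDF hα0 hα1 hK)).congr' ?_
  filter_upwards [self_mem_nhdsWithin] with t ht
  exact (ratioDensity_of_ne hα0 hα1 hmeas hlaw hindep hx j (ne_of_gt ht)).symm

lemma map_ratioStat_pi_eq_withDensity (hα0 : 0 < α) (hα1 : α < 1)
    (hmeas : ∀ t j, Measurable (s t j))
    (hlaw : ∀ t j, IsMaxSkewedStable α (P.map (s t j)))
    (hindep : iIndepFun (fun p : Fin N × Fin M => s p.1 p.2) P) (hx : x ∈ admissibleSignals i) :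
    P.map (fun ω j => ratioStat s x i j ω) =
      volume.withDensity fun z => ratioLikelihood P s i z x := by
  have hK := sum_erase_rpow_pos_of_mem_admissibleSignals (α := α) hx
  set ρ := stableRatioPDF α (∑ t ∈ Finset.univ.erase i, x t ^ α) (x i)
  have hρ0 : ∀ t, 0 ≤ ρ t := stableRatioPDF_nonneg hα0 hα1 hK
  have hlaw' := map_ratioStat_eq_withDensity hα0 hα1 hmeas hlaw hindep hx
  have hind : iIndepFun (fun j => ratioStat s x i j) P :=
    (iIndepFun_pi_of_prod hmeas hindep).comp (fun _ y => (∑ t, x t * y t) / y i) fun _ => by fun_prop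
  have hρ : ∀ _ : Fin M, Integrable ρ := fun j => by
    have := Measure.isProbabilityMeasure_map (μ := P) (measurable_ratioStat hmeas x i j).aemeasurable
    refine ⟨measurable_stableRatioPDF.aestronglyMeasurable, ?_⟩
    rw [hasFiniteIntegral_iff_ofReal (ae_of_all _ hρ0), ← setLIntegral_univ,
      ← withDensity_apply _ MeasurableSet.univ, ← hlaw' j]
    exact measure_lt_top _ _
  rw [(iIndepFun_iff_map_fun_eq_pi_map
    fun j => (measurable_ratioStat hmeas x i j).aemeasurable).1 hind]
  simp_rw [hlaw']
  rw [pi_withDensity_ofReal (fun _ : Fin M => ρ) (fun _ => hρ0) hρ]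
  refine withDensity_congr_ae ?_
  -- At `x i` the point density and `ρ` differ, but the points `z` with some coordinate equal to `x
  -- i` form a null set.
  have hne : ∀ᵐ z : Fin M → ℝ, ∀ j, z j ≠ x i := by
    rw [ae_all_iff]
    intro j
    have hq : Measure.QuasiMeasurePreserving (Function.eval j) (volume : Measure (Fin M → ℝ)) volume :=
      Measure.quasiMeasurePreserving_eval _ j
    exact hq.ae (Measure.ae_ne volume (x i))
  filter_upwards [hne] with z hz
  exact Finset.prod_congr rfl fun j _ =>
    (ratioDensity_of_ne hα0 hα1 hmeas hlaw hindep hx j (hz j)).symm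

/-- If `x i` is below the minimum, all factors are finite; if it is above, the factor at the minimum
is `0`, which wins even against `∞`. At equality that factor is `∞` and no other vanishes. -/
lemma ratioLikelihood_eq_top_iff [NeZero M] (hα0 : 0 < α) (hα1 : α ≤ 1 / 2)
    (hmeas : ∀ t j, Measurable (s t j))
    (hlaw : ∀ t j, IsMaxSkewedStable α (P.map (s t j)))
    (hindep : iIndepFun (fun p : Fin N × Fin M => s p.1 p.2) P) (hx : x ∈ admissibleSignals i)
    (z : Fin M → ℝ) :
    ratioLikelihood P s i z x = ⊤ ↔ x i = Finset.univ.inf' Finset.univ_nonempty z := by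
  obtain ⟨j₀, -, hj₀⟩ := Finset.exists_mem_eq_inf' (Finset.univ_nonempty (α := Fin M)) z
  have hle : ∀ j, z j₀ ≤ z j := fun j => hj₀ ▸ Finset.inf'_le z (Finset.mem_univ j)
  rw [hj₀]
  have hα1' : α < 1 := by linarith
  constructor
  · intro h
    rcases lt_trichotomy (x i) (z j₀) with hlt | heq | hgt
    · refine absurd h (ENNReal.prod_ne_top fun j _ => ?_)
      rw [ratioDensity_of_ne hα0 hα1' hmeas hlaw hindep hx j (hlt.trans_le (hle j)).ne']
      exact ENNReal.ofReal_ne_top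
    · exact heq
    · rw [ratioLikelihood, Finset.prod_eq_zero (Finset.mem_univ j₀)
        (ratioDensity_eq_zero_of_lt hα0 hα1' hmeas hlaw hindep hx j₀ hgt)] at h
      exact absurd h ENNReal.zero_ne_top
  · intro h
    rw [ratioLikelihood, ← Finset.mul_prod_erase _ _ (Finset.mem_univ j₀), ← h,
      ratioDensity_self hα0 hα1 hmeas hlaw hindep hx j₀]
    refine ENNReal.top_mul (Finset.prod_ne_zero_iff.2 fun j _ => ?_)
    exact ratioDensity_ne_zero_of_le hα0 hα1 hmeas hlaw hindep hx j (h ▸ hle j)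

end Likelihood

end MaxSkewedStable

theorem lemma4 {Ω : Type*} [MeasurableSpace Ω] (P : Measure Ω) [IsProbabilityMeasure P]
    {N M : ℕ} [NeZero M] (α : ℝ) (hα0 : 0 < α) (hα1 : α ≤ 1 / 2)
    (s : Fin N → Fin M → Ω → ℝ)
    (hmeas : ∀ t j, Measurable (s t j))
    (hlaw : ∀ t j, IsMaxSkewedStable α (P.map (s t j)))
    (hindep : iIndepFun (fun p : Fin N × Fin M => s p.1 p.2) P)
    (i : Fin N) :
    -- the density of the ratio statistics: it is the derivative of the distribution function,
    -- it blows up at `x i`, and it is nonincreasing beyond `x i`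
    (∀ x ∈ admissibleSignals i, ∀ j,
      P.map (ratioStat s x i j) = volume.withDensity (ratioDensity P s x i j) ∧
      (∀ t, t ≠ x i →
        HasDerivAt (fun u => P.real {ω | ratioStat s x i j ω ≤ u})
          (ratioDensity P s x i j t).toReal t) ∧
      Tendsto (ratioDensity P s x i j) (𝓝[>] (x i)) (𝓝 ⊤) ∧
      AntitoneOn (ratioDensity P s x i j) (Set.Ici (x i))) ∧
    -- the likelihood is the joint density of the ratio statistics, which exceed `x i`
    (∀ x ∈ admissibleSignals i,
      P.map (fun ω j => ratioStat s x i j ω) =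
        volume.withDensity (fun z => ratioLikelihood P s i z x) ∧
      ∀ᵐ ω ∂P, ∀ j, x i < ratioStat s x i j ω) ∧
    -- the maximum likelihood estimator of the `i`-th coordinate is the sample minimum
    (∀ z : Fin M → ℝ, (∀ j, 0 ≤ z j) → ∀ x ∈ admissibleSignals i,
      (IsMaxOn (ratioLikelihood P s i z) (admissibleSignals i) x ↔
        x i = Finset.univ.inf' Finset.univ_nonempty z)) := by
  have hα1' : α < 1 := by linarith
  refine ⟨fun x hx j => ⟨?_, fun t ht => ?_, tendsto_ratioDensity hα0 hα1' hmeas hlaw hindep hx j,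
    antitoneOn_ratioDensity hα0 hα1 hmeas hlaw hindep hx j⟩, fun x hx =>
    ⟨map_ratioStat_pi_eq_withDensity hα0 hα1' hmeas hlaw hindep hx, ?_⟩, fun z hz x hx => ?_⟩
  · rw [map_ratioStat_eq_withDensity hα0 hα1' hmeas hlaw hindep hx j]
    refine withDensity_congr_ae ?_
    filter_upwards [Measure.ae_ne volume (x i)] with t ht
    exact (ratioDensity_of_ne hα0 hα1' hmeas hlaw hindep hx j ht).symm
  · have hK := sum_erase_rpow_pos_of_mem_admissibleSignals (α := α) hx
    have hcdf : (fun u => P.real {ω | ratioStat s x i j ω ≤ u}) =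
        stableRatioCDF α (∑ t ∈ Finset.univ.erase i, x t ^ α) (x i) := by
      ext u
      rw [← measureReal_ratioStat_Iic hα0 hα1' hmeas hlaw hindep hx j u,
        map_measureReal_apply (measurable_ratioStat hmeas x i j) measurableSet_Iic]
      rfl
    rw [hcdf, ratioDensity_of_ne hα0 hα1' hmeas hlaw hindep hx j ht,
      ENNReal.toReal_ofReal (stableRatioPDF_nonneg hα0 hα1' hK t)]
    exact hasDerivAt_stableRatioCDF_of_ne hα0 hα1' hK ht
  · exact ae_all_iff.2 fun j => ae_lt_ratio_of_isMaxSkewedStable hα0 hα1' (fun t => hmeas t j)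
      (fun t => hlaw t j) (iIndepFun_column hindep j) hx.1 hx.2
  · have htop := fun {y} (hy : y ∈ admissibleSignals i) =>
      ratioLikelihood_eq_top_iff hα0 hα1 hmeas hlaw hindep hy z
    rw [← htop hx]
    refine ⟨fun hmax => ?_, fun h y _ => ?_⟩
    swap
    · rw [Set.mem_ofPred_eq, h]
      exact le_top
    set m := Finset.univ.inf' Finset.univ_nonempty z with hm
    -- A signal of infinite likelihood, so that any maximizer has infinite likelihood too. Its
    -- `i`-th coordinate is nonnegative because the `z j` are.
    have hy : Function.update x i m ∈ admissibleSignals i := by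
      obtain ⟨hx0, t₀, ht₀, hpos⟩ := hx
      refine ⟨fun t => ?_, t₀, ht₀, by rwa [Function.update_of_ne ht₀]⟩
      rcases eq_or_ne t i with rfl | h
      · rw [Function.update_self]
        exact Finset.le_inf' _ _ fun j _ => hz j
      · rw [Function.update_of_ne h]
        exact hx0 t
    have h1 := hmax hy
    rw [Set.mem_ofPred_eq, (htop hy).2 (Function.update_self ..)] at h1
    exact top_le_iff.1 h1
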